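/- Let $d\ge 1$ be an integer, let $\sigma>0$, and let $\|\cdot\|$ be the Euclidean norm on $\mathbb R^d$. Consider the Abel kernel $$K:\mathbb R^d\times\mathbb R^d\to\mathbb R,\qquad K(x,y)=e^{-\|x-y\|/\sigma}.$$ Then $K$ is positive definite, i.e. $\sum_{i,j=1}^N c_i\overline{c_j}\,K(x_j,x_i)\ge 0$ for all $N\in\mathbb N$, $x_1,\dots,x_N\in\mathbb R^d$ and $c_1,\dots,c_N\in\mathbb C$, and the corresponding reproducing kernel Hilbert space $\mathcal H$ of complex functions on $\mathbb R^d$ is completely separating. The latter means, with $K_x=K(\cdot,x)\in\mathcal H$, that: (i) $K_x\neq K_y$ whenever $x\ne y$, so that $d_K(x,y)=\|K_x-K_y\|_{\mathcal H}$ is a metric on $\mathbb R^d$; (ii) for every subset $C\subset\mathbb R^d$ that is closed with respect to $d_K$ and every $x\in\mathbb R^d\setminus C$, there exists $f\in\mathcal H$ such that $f(x)\neq 0$ and $f(y)=0$ for all $y\in C$. -/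

import Mathlib

/-- A complex kernel is positive definite (of positive type) if
`∑ i j, conj (c i) * K (x i) (x j) * c j ≥ 0` for all finitely many points and coefficients. -/
def IsPositiveDefiniteKernel {X : Type*} (K : X → X → ℂ) : Prop :=
  open scoped ComplexOrder in (Matrix.of K).PosSemidef

section CompletelySeparating

variable {X : Type*} (H : Type*) [NormedAddCommGroup H] [InnerProductSpace ℂ H] [CompleteSpace H]
  [RKHS ℂ H X ℂ]

/-- The section `K_x = K(·, x)` of the reproducing kernel, as an element of the reproducing kernel
Hilbert space `H`; every `f : H` satisfies `f x = ⟪K_x, f⟫`. -/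
noncomputable def kernelSection (x : X) : H := RKHS.kerFun H x 1

/-- `H` is the reproducing kernel Hilbert space corresponding to the scalar kernel `K`. -/
def HasReproducingKernel (K : X → X → ℂ) : Prop :=
  ∀ x y : X, kernelSection H y x = K x y

/-- `H` separates `C` if each point outside `C` admits an `f` in `H` that vanishes on `C` and
does not vanish at that point. -/
def Separates (C : Set X) : Prop :=
  ∀ x : X, x ∉ C → ∃ f : H, f x ≠ 0 ∧ ∀ y ∈ C, f y = 0

/-- The metric `d_K(x, y) = ‖K_x - K_y‖` on `X`, available when `x ↦ K_x` is injective. -/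
@[reducible] noncomputable def kernelMetric
    (hinj : Function.Injective (kernelSection H : X → H)) : MetricSpace X :=
  MetricSpace.induced (kernelSection H) hinj inferInstance

/-- `H` is completely separating if `K_x ≠ K_y` for `x ≠ y` and `H` separates every subset
of `X` which is closed for the metric `d_K`. -/
structure IsCompletelySeparating : Prop where
  injective : Function.Injective (kernelSection H : X → H)
  separates : ∀ C : Set X,
    @IsClosed X (kernelMetric H injective).toUniformSpace.toTopologicalSpace C → Separates H C

end CompletelySeparating

/-- Every positive definite kernel is the reproducing kernel of some Hilbert space of functions. -/
theorem IsPositiveDefiniteKernel.exists_rkhs.{u} {X : Type u} {K : X → X → ℂ}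
    (hK : IsPositiveDefiniteKernel K) :
    ∃ (H : Type u) (_ : NormedAddCommGroup H) (_ : InnerProductSpace ℂ H) (_ : CompleteSpace H)
      (_ : RKHS ℂ H X ℂ), HasReproducingKernel H K := by
  let K' : Matrix X X (ℂ →L[ℂ] ℂ) := .of fun x y ↦ K x y • ContinuousLinearMap.id ℂ ℂ
  have hP : K'.PosSemidef := by
    refine ((RKHS.posSemidef_tfae (K := K')).out 0 2 rfl rfl).mpr ⟨?_, fun vv ↦ ?_⟩
    · ext x y
      have hid : star (ContinuousLinearMap.id ℂ ℂ) = ContinuousLinearMap.id ℂ ℂ := star_one _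
      simpa [K', hid] using hK.1.apply x y
    · have h := (Complex.le_def.mp (hK.2 vv)).1
      have hconj : ∀ x y, (starRingEnd ℂ) (K x y) = K y x := fun x y ↦ hK.1.apply y x
      simpa [K', hconj, mul_assoc, mul_comm, mul_left_comm] using h
  have : Fact K'.PosSemidef := ⟨hP⟩
  refine ⟨RKHS.OfKernel K', inferInstance, inferInstance, inferInstance, inferInstance, ?_⟩
  intro x y
  simp [kernelSection, RKHS.kerFun_apply, RKHS.OfKernel.kernel_ofKernel, K']

/-- The Abel kernel `e^{-‖x - y‖ / σ}` on `ℝ^d` with the Euclidean norm. -/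
noncomputable def abelKernel (d : ℕ) (σ : ℝ) (x y : EuclideanSpace ℝ (Fin d)) : ℂ :=
  ((Real.exp (-(‖x - y‖ / σ)) : ℝ) : ℂ)

/-! Both `exp (-2 * π * ‖z‖)` and `(1 + ‖w‖ ^ 2) ^ (-(dim V + 1) / 2)` are mixtures of Gaussians, so
the former is the Fourier transform of a multiple of the latter (`exists_fourier_besselDensity`).
This density is positive, whence positive definiteness. It decays only polynomially, so a Schwartz
function divided by it stays Schwartz: every Schwartz function is a convolution with the kernel and,
up to scaling, lies in `H` as an integral of kernel sections. These sections vary continuously in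
`H`, so `d_K`-closed sets are Euclidean closed, and smooth bumps separate them from outside points.
-/

/-! ### The exponential as a mixture of Gaussians. -/

section Subordination

open Real Set Filter Topology MeasureTheory

/-- The unnormalised error function has limit `√π / 2` at infinity. -/
theorem tendsto_integral_exp_neg_sq_atTop :
    Tendsto (fun x : ℝ ↦ ∫ s in (0 : ℝ)..x, exp (-s ^ 2)) atTop (𝓝 (√π / 2)) := by
  have hint : Integrable fun s : ℝ ↦ exp (-s ^ 2) := by
    simpa using integrable_exp_neg_mul_sq one_pos
  have h := intervalIntegral_tendsto_integral_Ioi 0 hint.integrableOn tendsto_id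
  have h2 := integral_gaussian_Ioi 1
  simp only [neg_mul, one_mul, div_one] at h2
  rwa [h2] at h

theorem tendsto_integral_exp_neg_sq_atBot :
    Tendsto (fun x : ℝ ↦ ∫ s in (0 : ℝ)..x, exp (-s ^ 2)) atBot (𝓝 (-(√π / 2))) := by
  have h := (tendsto_integral_exp_neg_sq_atTop.comp tendsto_neg_atBot_atTop).neg
  refine h.congr fun x ↦ ?_
  have h2 := intervalIntegral.integral_comp_neg (a := 0) (b := x) fun s : ℝ ↦ exp (-s ^ 2)
  simp only [even_two, Even.neg_pow, neg_zero] at h2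
  rw [Function.comp_apply, h2, intervalIntegral.integral_symm, neg_neg]

theorem hasDerivAt_integral_exp_neg_sq (x : ℝ) :
    HasDerivAt (fun x : ℝ ↦ ∫ s in (0 : ℝ)..x, exp (-s ^ 2)) (exp (-x ^ 2)) x :=
  (by fun_prop : Continuous fun s : ℝ ↦ exp (-s ^ 2)).integral_hasStrictDerivAt 0 x
    |>.hasDerivAt

theorem integrableOn_exp_neg_sq_sub_div_sq (r : ℝ) :
    IntegrableOn (fun v : ℝ ↦ exp (-v ^ 2 - r ^ 2 / (4 * v ^ 2))) (Ioi 0) := by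
  have hint : Integrable fun s : ℝ ↦ exp (-s ^ 2) := by
    simpa using integrable_exp_neg_mul_sq one_pos
  refine hint.integrableOn.mono' (by fun_prop) (ae_of_all _ fun v ↦ ?_)
  rw [norm_of_nonneg (exp_pos _).le]
  exact exp_le_exp.2 (sub_le_self _ (by positivity))

/-- Subordination of the exponential to Gaussians. -/
theorem integral_exp_neg_sq_sub_div_sq {r : ℝ} (hr : 0 ≤ r) :
    ∫ v in Ioi (0 : ℝ), exp (-v ^ 2 - r ^ 2 / (4 * v ^ 2)) = √π / 2 * exp (-r) := by
  rcases hr.eq_or_lt with rfl | hr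
  · simpa using integral_gaussian_Ioi 1
  set F : ℝ → ℝ := fun x ↦ ∫ s in (0 : ℝ)..x, exp (-s ^ 2) with hF
  -- Explicit antiderivative of twice the integrand. The `exp r` terms have the same limit at both
  -- ends and cancel; the `exp (-r)` terms contribute `√π * exp (-r)`.
  let g : ℝ → ℝ := fun v ↦ exp r * F (v + r / 2 * v⁻¹) + exp (-r) * F (v - r / 2 * v⁻¹)
  have hinv : Tendsto (fun v : ℝ ↦ r / 2 * v⁻¹) (𝓝[>] 0) atTop :=
    tendsto_inv_nhdsGT_zero.const_mul_atTop (by positivity)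
  have hinv' : Tendsto (fun v : ℝ ↦ r / 2 * v⁻¹) atTop (𝓝 0) := by
    simpa using tendsto_inv_atTop_zero.const_mul (r / 2)
  have hid : Tendsto (fun v : ℝ ↦ v) (𝓝[>] 0) (𝓝 0) := nhdsWithin_le_nhds
  have h0 : Tendsto g (𝓝[>] 0) (𝓝 (exp r * (√π / 2) + exp (-r) * -(√π / 2))) := by
    refine ((tendsto_integral_exp_neg_sq_atTop.comp (hid.add_atTop hinv)).const_mul _).add
      ((tendsto_integral_exp_neg_sq_atBot.comp ?_).const_mul _)
    simpa only [sub_eq_add_neg, Function.comp_apply] using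
      hid.add_atBot (tendsto_neg_atTop_atBot.comp hinv)
  have hinf : Tendsto g atTop (𝓝 (exp r * (√π / 2) + exp (-r) * (√π / 2))) := by
    refine ((tendsto_integral_exp_neg_sq_atTop.comp (tendsto_id.atTop_add hinv')).const_mul _).add
      ((tendsto_integral_exp_neg_sq_atTop.comp ?_).const_mul _)
    simpa only [sub_eq_add_neg, id] using tendsto_id.atTop_add hinv'.neg
  have hderiv : ∀ v ∈ Ioi (0 : ℝ),
      HasDerivAt g (2 * exp (-v ^ 2 - r ^ 2 / (4 * v ^ 2))) v := by
    intro v hv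
    have hv0 : v ≠ 0 := (ne_of_gt hv)
    have hi := (hasDerivAt_inv hv0).const_mul (r / 2)
    have h1 := ((hasDerivAt_integral_exp_neg_sq _).comp v
      ((hasDerivAt_id' v).add hi)).const_mul (exp r)
    have h2 := ((hasDerivAt_integral_exp_neg_sq _).comp v
      ((hasDerivAt_id' v).sub hi)).const_mul (exp (-r))
    refine (h1.add h2).congr_deriv ?_
    have e1 : exp r * exp (-(v + r / 2 * v⁻¹) ^ 2) = exp (-v ^ 2 - r ^ 2 / (4 * v ^ 2)) := by
      rw [← exp_add]; congr 1; field_simp; ring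
    have e2 : exp (-r) * exp (-(v - r / 2 * v⁻¹) ^ 2) = exp (-v ^ 2 - r ^ 2 / (4 * v ^ 2)) := by
      rw [← exp_add]; congr 1; field_simp; ring
    simp only [Pi.add_apply, Pi.sub_apply]
    rw [← mul_assoc, ← mul_assoc, e1, e2]
    ring
  -- Integration by parts against `1` only asks for one-sided limits. Since `0⁻¹ = 0`, the value `g
  -- 0 = 0` is not the limit of `g` at `0`.
  have key := integral_Ioi_deriv_mul_eq_sub (u := g) (v := fun _ ↦ (1 : ℝ)) (v' := fun _ ↦ 0)
    (a := 0) hderiv (fun x _ ↦ hasDerivAt_const x 1)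
    (by simpa [Pi.mul_def, Pi.add_def, IntegrableOn] using
      (integrableOn_exp_neg_sq_sub_div_sq r).const_mul 2)
    (by simpa [Pi.mul_def] using h0) (by simpa [Pi.mul_def] using hinf)
  simp only [mul_one, mul_zero, add_zero, integral_const_mul] at key
  linarith

end Subordination

/-! ### Fourier transform of the polynomially decaying density. -/

section BesselDensity

open Real Set Filter Topology MeasureTheory FourierTransform Module

variable {V : Type*} [NormedAddCommGroup V] [InnerProductSpace ℝ V]

variable (V) in
/-- The density `(1 + ‖w‖ ^ 2) ^ (-(dim V + 1) / 2)`, whose Fourier transform is a multiple of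
`exp (-2 * π * ‖z‖)`. -/
noncomputable def besselDensity (w : V) : ℝ :=
  (1 + ‖w‖ ^ 2) ^ (-((finrank ℝ V : ℝ) + 1) / 2)

theorem besselDensity_pos (w : V) : 0 < besselDensity V w := by
  unfold besselDensity; positivity

variable [FiniteDimensional ℝ V] [MeasurableSpace V] [BorelSpace V]

theorem integrable_besselDensity : Integrable (besselDensity V) :=
  integrable_rpow_neg_one_add_norm_sq (by linarith)

/-- For `b = 1 + ‖w‖ ^ 2` and `n = dim V` this exhibits `besselDensity` as a mixture of Gaussians in
`w`. -/
theorem integral_pow_mul_exp_neg_mul_sq (n : ℕ) {b : ℝ} (hb : 0 < b) :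
    ∫ v in Ioi (0 : ℝ), v ^ n * exp (-b * v ^ 2) =
      b ^ (-((n : ℝ) + 1) / 2) * (1 / 2 * Gamma (((n : ℝ) + 1) / 2)) := by
  have hn : (-1 : ℝ) < n := by linarith [n.cast_nonneg (α := ℝ)]
  have h := integral_rpow_mul_exp_neg_mul_rpow (p := 2) two_pos hn hb
  simp only [rpow_natCast, rpow_two] at h
  rw [h, mul_assoc]

theorem integrableOn_pow_mul_exp_neg_mul_sq (n : ℕ) {b : ℝ} (hb : 0 < b) :
    IntegrableOn (fun v : ℝ ↦ v ^ n * exp (-b * v ^ 2)) (Ioi 0) := by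
  have hn : (-1 : ℝ) < n := by linarith [n.cast_nonneg (α := ℝ)]
  simpa only [rpow_natCast] using integrableOn_rpow_mul_exp_neg_mul_sq hb hn

theorem integrable_pow_mul_exp_neg_mul_sq_prod :
    Integrable (fun p : ℝ × V ↦ p.1 ^ finrank ℝ V * exp (-(1 + ‖p.2‖ ^ 2) * p.1 ^ 2))
      ((volume.restrict (Ioi 0)).prod volume) := by
  rw [integrable_prod_iff' (by fun_prop)]
  refine ⟨ae_of_all _ fun w ↦ integrableOn_pow_mul_exp_neg_mul_sq (finrank ℝ V)
    (b := 1 + ‖w‖ ^ 2) (by positivity), ?_⟩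
  refine (integrable_besselDensity.mul_const
    (1 / 2 * Gamma (((finrank ℝ V : ℝ) + 1) / 2))).congr (ae_of_all _ fun w ↦ ?_)
  dsimp only
  rw [besselDensity, ← integral_pow_mul_exp_neg_mul_sq _ (by positivity)]
  refine setIntegral_congr_fun measurableSet_Ioi fun v hv ↦ ?_
  have : (0 : ℝ) < v := hv
  exact (norm_of_nonneg (by positivity)).symm

/-- The weight `v ^ dim V` cancels the normalisation of the transformed Gaussian. -/
theorem fourier_exp_neg_sq_mul_norm_sq {v : ℝ} (hv : 0 < v) (z : V) :
    ((v ^ finrank ℝ V : ℝ) : ℂ) * 𝓕 (fun w : V ↦ ((exp (-v ^ 2 * ‖w‖ ^ 2) : ℝ) : ℂ)) z =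
      ((√π ^ finrank ℝ V * exp (-(π ^ 2 * ‖z‖ ^ 2 / v ^ 2)) : ℝ) : ℂ) := by
  have h := fourier_gaussian_innerProductSpace (V := V) (b := ((v ^ 2 : ℝ) : ℂ))
    (by rw [Complex.ofReal_re]; positivity) z
  have e : (fun w : V ↦ ((exp (-v ^ 2 * ‖w‖ ^ 2) : ℝ) : ℂ)) =
      fun w : V ↦ Complex.exp (-((v ^ 2 : ℝ) : ℂ) * ‖w‖ ^ 2) := by
    ext w; push_cast; rfl
  have e2 : ((π : ℂ) / ((v ^ 2 : ℝ) : ℂ)) ^ ((finrank ℝ V : ℂ) / 2) =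
      (((√π / v) ^ finrank ℝ V : ℝ) : ℂ) := by
    have : (π / v ^ 2) ^ ((finrank ℝ V : ℝ) / 2) = (√π / v) ^ finrank ℝ V := by
      rw [div_eq_inv_mul (finrank ℝ V : ℝ), rpow_mul (by positivity), rpow_natCast,
        ← one_div, ← sqrt_eq_rpow, sqrt_div pi_pos.le, sqrt_sq hv.le]
    rw [← this, Complex.ofReal_cpow (by positivity)]
    push_cast; rfl
  rw [e, h, e2, div_pow]
  push_cast
  have : (v : ℂ) ≠ 0 := by exact_mod_cast hv.ne'
  field_simp

/-- The constant relating `exp (-2 * π * ‖z‖)` to the Fourier transform of `besselDensity`. -/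
theorem exists_fourier_besselDensity :
    ∃ c : ℝ, 0 < c ∧ ∀ z : V,
      𝓕 (fun w : V ↦ ((c * besselDensity V w : ℝ) : ℂ)) z = ((exp (-(2 * π * ‖z‖)) : ℝ) : ℂ) := by
  set n := finrank ℝ V with hn
  set γ : ℝ := 1 / 2 * Gamma (((n : ℝ) + 1) / 2) with hγ
  have hγ0 : 0 < γ := mul_pos (by norm_num) (Gamma_pos_of_pos (by positivity))
  have hpi : 0 < √π := sqrt_pos.2 pi_pos
  suffices h : ∀ z : V, ((√π ^ n * (√π / 2 * exp (-(2 * π * ‖z‖))) : ℝ) : ℂ) =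
      γ * 𝓕 (fun w : V ↦ (besselDensity V w : ℂ)) z by
    refine ⟨γ / (√π ^ n * (√π / 2)), by positivity, fun z ↦ ?_⟩
    have hc : ((√π ^ n * (√π / 2) : ℝ) : ℂ) ≠ 0 := by
      exact_mod_cast (by positivity : √π ^ n * (√π / 2) ≠ 0)
    have hsmul : 𝓕 (fun w : V ↦ ((γ / (√π ^ n * (√π / 2)) * besselDensity V w : ℝ) : ℂ)) z =
        ((γ / (√π ^ n * (√π / 2)) : ℝ) : ℂ) * 𝓕 (fun w : V ↦ (besselDensity V w : ℂ)) z := by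
      rw [Real.fourier_eq, Real.fourier_eq, ← integral_const_mul]
      refine integral_congr_ae (ae_of_all _ fun w ↦ ?_)
      simp only [Circle.smul_def, smul_eq_mul, Complex.ofReal_mul]
      ring
    rw [hsmul, Complex.ofReal_div, div_mul_eq_mul_div, ← h z, div_eq_iff hc]
    push_cast; ring
  intro z
  -- Integrating over `v` first gives the transform of the density; over `w` first, the
  -- subordination integral with `r = 2 * π * ‖z‖`.
  let Φ : ℝ → V → ℂ := fun v w ↦ 𝐞 (-inner ℝ w z) •
    ((v ^ n * exp (-(1 + ‖w‖ ^ 2) * v ^ 2) : ℝ) : ℂ)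
  have hΦ : Integrable (Function.uncurry Φ) ((volume.restrict (Ioi 0)).prod volume) := by
    refine (integrable_pow_mul_exp_neg_mul_sq_prod (V := V)).ofReal (𝕜 := ℂ) |>.mono ?_ ?_
    · refine Continuous.aestronglyMeasurable ?_
      simp only [Φ, Function.uncurry_def]
      fun_prop
    · refine ae_of_all _ fun p ↦ ?_
      simp [Φ, Function.uncurry_def, hn]
  have hswap := integral_integral_swap hΦ
  have hl : ∀ v ∈ Ioi (0 : ℝ), ∫ w, Φ v w =
      ((√π ^ n * exp (-v ^ 2 - (2 * π * ‖z‖) ^ 2 / (4 * v ^ 2)) : ℝ) : ℂ) := by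
    intro v hv
    have h := fourier_exp_neg_sq_mul_norm_sq hv z
    calc ∫ w, Φ v w = ((exp (-v ^ 2) : ℝ) : ℂ) * (((v ^ n : ℝ) : ℂ) *
          𝓕 (fun w : V ↦ ((exp (-v ^ 2 * ‖w‖ ^ 2) : ℝ) : ℂ)) z) := by
          rw [Real.fourier_eq, ← integral_const_mul, ← integral_const_mul]
          refine integral_congr_ae (ae_of_all _ fun w ↦ ?_)
          simp only [Φ, Circle.smul_def, smul_eq_mul]
          rw [show -(1 + ‖w‖ ^ 2) * v ^ 2 = -v ^ 2 + -v ^ 2 * ‖w‖ ^ 2 by ring, exp_add]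
          push_cast; ring
      _ = _ := by
          rw [h, ← Complex.ofReal_mul, mul_left_comm, ← exp_add]
          congr 4
          have : v ≠ 0 := ne_of_gt hv
          field_simp; ring
  have hr : ∀ w, ∫ v in Ioi (0 : ℝ), Φ v w = γ * (𝐞 (-inner ℝ w z) • (besselDensity V w : ℂ)) := by
    intro w
    simp only [Φ, Circle.smul_def, smul_eq_mul]
    rw [integral_const_mul, integral_complex_ofReal, integral_pow_mul_exp_neg_mul_sq n (by positivity),
      besselDensity, ← hn, ← hγ]
    push_cast; ring
  rw [setIntegral_congr_fun measurableSet_Ioi hl, integral_complex_ofReal, integral_const_mul,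
    integral_exp_neg_sq_sub_div_sq (by positivity)] at hswap
  rw [hswap, Real.fourier_eq, ← integral_const_mul]
  exact integral_congr_ae (ae_of_all _ hr)

end BesselDensity

/-! ### Positive definiteness and deconvolution by Fourier transform. -/

section TranslationInvariantKernels

open Real Filter Topology MeasureTheory FourierTransform Module

variable {V : Type*} [NormedAddCommGroup V] [InnerProductSpace ℝ V] [FiniteDimensional ℝ V]
  [MeasurableSpace V] [BorelSpace V]

/-- The Fourier transform of a nonnegative integrable density is a function of positive type. -/
theorem isPositiveDefiniteKernel_fourier {X : Type*} {k : V → ℝ} (hk : Integrable k)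
    (hk0 : ∀ w, 0 ≤ k w) (φ : X → V) :
    IsPositiveDefiniteKernel fun x y ↦ 𝓕 (fun w ↦ (k w : ℂ)) (φ x - φ y) := by
  have hK : ∀ x y, 𝓕 (fun w ↦ (k w : ℂ)) (φ x - φ y) =
      ∫ w, star (𝐞 (inner ℝ w (φ x)) : ℂ) * 𝐞 (inner ℝ w (φ y)) * k w := by
    intro x y
    rw [Real.fourier_eq]
    refine integral_congr_ae (ae_of_all _ fun w ↦ ?_)
    dsimp only
    rw [inner_sub_right, neg_sub, sub_eq_neg_add, AddChar.map_add_eq_mul, Circle.smul_def,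
      smul_eq_mul, Circle.coe_mul, AddChar.map_neg_eq_inv, Circle.coe_inv_eq_conj]
    rfl
  constructor
  · ext x y
    simp only [Matrix.conjTranspose_apply, Matrix.of_apply, hK]
    rw [← starRingEnd_apply, ← integral_conj]
    refine integral_congr_ae (ae_of_all _ fun w ↦ ?_)
    simp only [map_mul, RCLike.star_def, Complex.conj_conj, Complex.conj_ofReal]
    ring
  · intro c
    -- The quadratic form is the integral of `|S| ^ 2` against `k`.
    let S : V → ℂ := fun w ↦ ∑ j ∈ c.support, c j * 𝐞 (inner ℝ w (φ j))
    suffices h : (c.sum fun i xi ↦ c.sum fun j xj ↦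
        star xi * 𝓕 (fun w ↦ (k w : ℂ)) (φ i - φ j) * xj) =
        ((∫ w, Complex.normSq (S w) * k w : ℝ) : ℂ) by
      refine h.symm ▸ Complex.zero_le_real.2 (integral_nonneg fun w ↦ ?_)
      exact mul_nonneg (Complex.normSq_nonneg _) (hk0 w)
    have hint : ∀ i j, Integrable fun w ↦ star (c i) *
        (star (𝐞 (inner ℝ w (φ i)) : ℂ) * 𝐞 (inner ℝ w (φ j)) * k w) * c j := by
      intro i j
      refine ((Integrable.mono (hk.ofReal (𝕜 := ℂ)) ?_ ?_).const_mul _).mul_const _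
      · refine (Continuous.aestronglyMeasurable ?_).mul hk.ofReal.aestronglyMeasurable
        fun_prop
      · exact ae_of_all _ fun w ↦ by
          rw [norm_mul, norm_mul, norm_star, Circle.norm_coe, Circle.norm_coe, one_mul, one_mul]
          rfl
    simp only [Finsupp.sum, hK]
    simp_rw [← integral_const_mul, ← integral_mul_const]
    simp_rw [← integral_finsetSum _ fun j _ ↦ hint _ j]
    rw [← integral_finsetSum _ fun i _ ↦ integrable_finsetSum _ fun j _ ↦ hint i j,
      ← integral_complex_ofReal]
    refine integral_congr_ae (ae_of_all _ fun w ↦ ?_)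
    dsimp only
    rw [Complex.ofReal_mul, ← Complex.mul_conj, mul_comm (S w), map_sum, Finset.sum_mul_sum,
      Finset.sum_mul]
    refine Finset.sum_congr rfl fun i _ ↦ ?_
    rw [Finset.sum_mul]
    refine Finset.sum_congr rfl fun j _ ↦ ?_
    simp only [map_mul, RCLike.star_def]
    ring

/-- Every Schwartz function is the convolution of `exp (-2 * π * ‖·‖)` with a Schwartz function. -/
theorem exists_schwartzMap_integral_mul_exp_neg_norm_eq (g : SchwartzMap V ℂ) :
    ∃ h : SchwartzMap V ℂ, ∀ x : V,
      ∫ z, h z * ((exp (-(2 * π * ‖x - z‖)) : ℝ) : ℂ) = g x := by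
  obtain ⟨c, hc, hG⟩ := exists_fourier_besselDensity (V := V)
  -- The reciprocal of the density; its temperate growth keeps `p * 𝓕 g` Schwartz.
  let p : V → ℂ := fun w ↦
    ((c⁻¹ * (1 + ‖w‖ ^ 2) ^ (((finrank ℝ V : ℝ) + 1) / 2) : ℝ) : ℂ)
  have hp : p.HasTemperateGrowth := by fun_prop
  let q : SchwartzMap V ℂ := SchwartzMap.smulLeftCLM ℂ p (𝓕 g)
  have hpk : ∀ w, p w * ((c * besselDensity V w : ℝ) : ℂ) = 1 := by
    intro w
    simp only [p, besselDensity]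
    rw [← Complex.ofReal_mul, mul_mul_mul_comm, inv_mul_cancel₀ hc.ne', one_mul,
      ← rpow_add (by positivity), neg_div, add_neg_cancel, rpow_zero, Complex.ofReal_one]
  refine ⟨𝓕⁻ q, fun x ↦ ?_⟩
  -- Modulation by `x` turns the transform of the density into the kernel centred at `x`.
  let φ : V → ℂ := fun w ↦ 𝐞 (inner ℝ w x) • ((c * besselDensity V w : ℝ) : ℂ)
  have hφ : Integrable φ := by
    refine Integrable.mono ((integrable_besselDensity.const_mul c).ofReal (𝕜 := ℂ)) ?_ ?_
    · simp only [φ, Circle.smul_def, smul_eq_mul]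
      refine (Continuous.aestronglyMeasurable ?_).mul
        (integrable_besselDensity.const_mul c).ofReal.aestronglyMeasurable
      fun_prop
    · exact ae_of_all _ fun w ↦ by simp [φ]
  have hFφ : ∀ z, 𝓕 φ z = ((exp (-(2 * π * ‖x - z‖)) : ℝ) : ℂ) := by
    intro z
    rw [norm_sub_rev, ← hG, Real.fourier_eq, Real.fourier_eq]
    refine integral_congr_ae (ae_of_all _ fun w ↦ ?_)
    simp only [φ]
    rw [smul_smul, ← AddChar.map_add_eq_mul, inner_sub_right]
    congr 2
    ring
  have hflip : ∫ w, 𝓕 (𝓕⁻ q) w * φ w = ∫ z, 𝓕⁻ q z * 𝓕 φ z := by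
    have := VectorFourier.integral_fourierIntegral_smul_eq_flip (L := innerₗ V)
      continuous_fourierChar continuous_inner (𝓕⁻ q).integrable (μ := volume) (ν := volume) hφ
    rwa [flip_innerₗ] at this
  simp_rw [← hFφ]
  rw [← hflip, FourierTransform.fourier_fourierInv_eq]
  calc ∫ w, q w * φ w = ∫ w, 𝐞 (inner ℝ w x) • 𝓕 g w := by
        refine integral_congr_ae (ae_of_all _ fun w ↦ ?_)
        simp only [q, φ]
        rw [SchwartzMap.smulLeftCLM_apply_apply hp, Circle.smul_def, Circle.smul_def,
          smul_eq_mul, smul_eq_mul, smul_eq_mul]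
        linear_combination (𝐞 (inner ℝ w x) * 𝓕 g w : ℂ) * hpk w
    _ = g x := by
        rw [← Real.fourierInv_eq, ← SchwartzMap.fourierInv_coe,
          FourierTransform.fourierInv_fourier_eq]

end TranslationInvariantKernels

/-! ### Kernel sections: norms, continuity, integrals. -/

section ReproducingKernels

open Real Filter Topology MeasureTheory

variable {X : Type*} {H : Type*} [NormedAddCommGroup H] [InnerProductSpace ℂ H] [CompleteSpace H]
  [RKHS ℂ H X ℂ] {K : X → X → ℂ}

theorem inner_kernelSection_left (x : X) (f : H) : inner ℂ (kernelSection H x) f = f x := by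
  simp [kernelSection]

theorem HasReproducingKernel.inner_kernelSection (hK : HasReproducingKernel H K) (x y : X) :
    inner ℂ (kernelSection H x) (kernelSection H y) = K x y := by
  rw [inner_kernelSection_left, hK]

theorem HasReproducingKernel.norm_sub_eq (hK : HasReproducingKernel H K) (x y : X) :
    ‖kernelSection H x - kernelSection H y‖ = √(K x x - K x y - (K y x - K y y)).re := by
  rw [norm_eq_sqrt_re_inner (𝕜 := ℂ), inner_sub_left, inner_sub_right, inner_sub_right,
    hK.inner_kernelSection, hK.inner_kernelSection, hK.inner_kernelSection,
    hK.inner_kernelSection]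
  rfl

theorem HasReproducingKernel.norm_eq (hK : HasReproducingKernel H K) (x : X) :
    ‖kernelSection H x‖ = √(K x x).re := by
  rw [norm_eq_sqrt_re_inner (𝕜 := ℂ), hK.inner_kernelSection]
  rfl

theorem HasReproducingKernel.continuous_kernelSection [TopologicalSpace X]
    (hK : HasReproducingKernel H K) (hc : Continuous fun p : X × X ↦ K p.1 p.2) :
    Continuous (kernelSection H : X → H) := by
  have hc' : ∀ {u v : X → X}, Continuous u → Continuous v → Continuous fun y ↦ K (u y) (v y) :=
    fun hu hv ↦ hc.comp (hu.prodMk hv)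
  refine continuous_iff_continuousAt.2 fun x ↦ tendsto_iff_norm_sub_tendsto_zero.2 ?_
  simp_rw [hK.norm_sub_eq]
  have h : Continuous fun y ↦ √(K y y - K y x - (K x y - K x x)).re :=
    continuous_sqrt.comp (Complex.continuous_re.comp
      (((hc' continuous_id continuous_id).sub (hc' continuous_id continuous_const)).sub
        ((hc' continuous_const continuous_id).sub continuous_const)))
  simpa using h.tendsto x

theorem HasReproducingKernel.integral_smul_apply (hK : HasReproducingKernel H K) {α : Type*}
    [MeasurableSpace α] {μ : Measure α} {h : α → ℂ} {φ : α → X}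
    (hi : Integrable (fun z ↦ h z • kernelSection H (φ z)) μ) (x : X) :
    (∫ z, h z • kernelSection H (φ z) ∂μ : H) x = ∫ z, h z * K x (φ z) ∂μ := by
  rw [← inner_kernelSection_left, ← integral_inner hi]
  simp_rw [inner_smul_right, hK.inner_kernelSection]

end ReproducingKernels

/-! ### Complete separation for the Abel kernel. -/

section AbelKernel

open Real Filter Topology MeasureTheory

variable {d : ℕ} {σ : ℝ}

theorem abelKernel_eq_exp_neg_norm_smul_sub (hσ : 0 < σ) (x y : EuclideanSpace ℝ (Fin d)) :
    abelKernel d σ x y =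
      ((exp (-(2 * π * ‖(2 * π * σ)⁻¹ • x - (2 * π * σ)⁻¹ • y‖)) : ℝ) : ℂ) := by
  rw [abelKernel, ← smul_sub, norm_smul, norm_of_nonneg (by positivity)]
  congr 3
  field_simp

theorem isPositiveDefiniteKernel_abelKernel (hσ : 0 < σ) :
    IsPositiveDefiniteKernel (abelKernel d σ) := by
  obtain ⟨c, hc, hG⟩ := exists_fourier_besselDensity (V := EuclideanSpace ℝ (Fin d))
  have h := isPositiveDefiniteKernel_fourier (integrable_besselDensity.const_mul c)
    (fun w ↦ (mul_pos hc (besselDensity_pos w)).le)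
    fun x : EuclideanSpace ℝ (Fin d) ↦ (2 * π * σ)⁻¹ • x
  convert h using 3 with x y
  rw [hG, abelKernel_eq_exp_neg_norm_smul_sub hσ]

theorem continuous_abelKernel :
    Continuous fun p : EuclideanSpace ℝ (Fin d) × EuclideanSpace ℝ (Fin d) ↦
      abelKernel d σ p.1 p.2 := by
  unfold abelKernel
  fun_prop

@[simp]
theorem abelKernel_self (x : EuclideanSpace ℝ (Fin d)) : abelKernel d σ x x = 1 := by
  simp [abelKernel]

variable {H : Type*} [NormedAddCommGroup H] [InnerProductSpace ℂ H] [CompleteSpace H]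
  [RKHS ℂ H (EuclideanSpace ℝ (Fin d)) ℂ]

theorem HasReproducingKernel.injective_kernelSection_abelKernel (hσ : 0 < σ)
    (hK : HasReproducingKernel H (abelKernel d σ)) :
    Function.Injective (kernelSection H : EuclideanSpace ℝ (Fin d) → H) := by
  intro x y hxy
  have h := hK x y
  rw [← hxy, hK, abelKernel_self, abelKernel] at h
  have h2 : exp (-(‖x - y‖ / σ)) = 1 := by exact_mod_cast h.symm
  rw [exp_eq_one_iff, neg_eq_zero, div_eq_zero_iff] at h2
  exact sub_eq_zero.1 (norm_eq_zero.1 (h2.resolve_right hσ.ne'))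

/-- Up to scaling, Schwartz functions lie in the reproducing kernel Hilbert space of the Abel
kernel. -/
theorem HasReproducingKernel.exists_apply_eq_schwartzMap (hσ : 0 < σ)
    (hK : HasReproducingKernel H (abelKernel d σ))
    (g : SchwartzMap (EuclideanSpace ℝ (Fin d)) ℂ) :
    ∃ f : H, ∀ x, f x = g ((2 * π * σ)⁻¹ • x) := by
  obtain ⟨h, hh⟩ := exists_schwartzMap_integral_mul_exp_neg_norm_eq g
  have hcont := hK.continuous_kernelSection continuous_abelKernel
  -- Sections have norm one, so integrability of `h` suffices.
  have hi : Integrable fun z ↦ h z • kernelSection H ((2 * π * σ) • z) := by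
    refine h.integrable.norm.mono' (Continuous.aestronglyMeasurable ?_)
      (ae_of_all _ fun z ↦ ?_)
    · exact h.continuous.smul (hcont.comp (continuous_const_smul _))
    · simp [norm_smul, hK.norm_eq]
  refine ⟨∫ z, h z • kernelSection H ((2 * π * σ) • z), fun x ↦ ?_⟩
  rw [hK.integral_smul_apply hi, ← hh]
  refine integral_congr_ae (ae_of_all _ fun z ↦ ?_)
  dsimp only
  rw [abelKernel_eq_exp_neg_norm_smul_sub hσ, inv_smul_smul₀ (by positivity)]

theorem exists_schwartzMap_ne_zero_eq_zero {V : Type*} [NormedAddCommGroup V]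
    [InnerProductSpace ℝ V] [FiniteDimensional ℝ V] {C : Set V} (hC : IsClosed C) {x : V}
    (hx : x ∉ C) : ∃ g : SchwartzMap V ℂ, g x ≠ 0 ∧ ∀ y ∈ C, g y = 0 := by
  obtain ⟨f, hfC, hfc, hfs, -, hfx⟩ :=
    exists_contDiff_tsupport_subset (n := ⊤) (hC.isOpen_compl.mem_nhds hx)
  have hc : HasCompactSupport fun y ↦ (f y : ℂ) :=
    hfc.comp_left (g := Complex.ofReal) Complex.ofReal_zero
  have hs : ContDiff ℝ (⊤ : ℕ∞) fun y ↦ (f y : ℂ) := Complex.ofRealCLM.contDiff.comp hfs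
  have hg : ∀ y, hc.toSchwartzMap hs y = f y := fun y ↦ rfl
  refine ⟨hc.toSchwartzMap hs, by simp [hg, hfx], fun y hy ↦ ?_⟩
  rw [hg, image_eq_zero_of_notMem_tsupport fun h ↦ hfC h hy, Complex.ofReal_zero]

theorem HasReproducingKernel.isCompletelySeparating_abelKernel (hσ : 0 < σ)
    (hK : HasReproducingKernel H (abelKernel d σ)) : IsCompletelySeparating H := by
  refine ⟨hK.injective_kernelSection_abelKernel hσ, fun C hC x hx ↦ ?_⟩
  -- A `d_K`-closed set is the preimage of a closed set of `H`, hence Euclidean closed by continuity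
  -- of the sections.
  obtain ⟨D, hD, rfl⟩ := isClosed_induced_iff.1 hC
  have hcont := hK.continuous_kernelSection continuous_abelKernel
  have hs : (2 * π * σ) ≠ 0 := by positivity
  obtain ⟨g, hgx, hgC⟩ := exists_schwartzMap_ne_zero_eq_zero
    ((hD.preimage hcont).preimage (continuous_const_smul (2 * π * σ)))
    (x := (2 * π * σ)⁻¹ • x) (by rwa [Set.mem_preimage, Set.mem_preimage, smul_inv_smul₀ hs])
  obtain ⟨f, hf⟩ := hK.exists_apply_eq_schwartzMap hσ g
  refine ⟨f, by rwa [hf], fun y hy ↦ ?_⟩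
  rw [hf]
  exact hgC _ (by rwa [Set.mem_preimage, Set.mem_preimage, smul_inv_smul₀ hs])

end AbelKernel

theorem mainTheorem5 (d : ℕ) (hd : 1 ≤ d) (σ : ℝ) (hσ : 0 < σ) :
    IsPositiveDefiniteKernel (abelKernel d σ) ∧
    ∀ (H : Type*) [NormedAddCommGroup H] [InnerProductSpace ℂ H] [CompleteSpace H]
      [RKHS ℂ H (EuclideanSpace ℝ (Fin d)) ℂ],
      HasReproducingKernel H (abelKernel d σ) → IsCompletelySeparating H :=
  ⟨isPositiveDefiniteKernel_abelKernel hσ,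
    fun _ _ _ _ _ hK ↦ hK.isCompletelySeparating_abelKernel hσ⟩
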